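/- Let $n\ge 0$, let $g\colon\{0,1\}^n\to\{0,1\}$, let $\epsilon\in[0,1/2]$, and let $g^\oplus(x,y):=g(x\oplus y)$ for $x,y\in\{0,1\}^n$, where $\oplus$ is the coordinatewise XOR. Let $R_\epsilon(g^\oplus)$ be the randomized communication complexity of $g^\oplus$ with shared randomness: the least $c$ for which there is a probability distribution over deterministic two-party protocols, each exchanging at most $c$ bits, whose output (determined by the transcript) differs from $g^\oplus(x,y)$ with probability at most $\epsilon$ for every input $(x,y)$. For Fourier analysis replace the bits $0,1$ by $+1,-1$, in the arguments and in the values of $g$, so that $g\colon\{+1,-1\}^n\to\{+1,-1\}$. For $A\colon\{+1,-1\}^n\to\mathbb{R}$ and $S\subseteq[n]$ put $\widehat A(S):=2^{-n}\sum_{z}A(z)\prod_{i\in S}z_i$, $\|\widehat A\|_1:=\sum_{S}|\widehat A(S)|$ and $\|\widehat A\|_0:=|\{S\mid\widehat A(S)\neq0\}|$. For $x\in\{+1,-1\}^n$ put $S_x:=\{i\mid x_i=-1\}$, and let $g^*$ be the set of all functions $h\colon\{+1,-1\}^n\to[-1,1]$ with $h(x)=\widehat g(S_x)/|\widehat g(S_x)|$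 for all $x$ with $\widehat g(S_x)\ne0$. Then the minimum $\|\widehat{g^*}\|_1:=\min\{\|\widehat h\|_1\mid h\in g^*\}$ exists, and, with logarithms to base $2$, $$R_\epsilon(g^\oplus)\ \ge\ 2\log\big((1-\epsilon)\|\widehat g\|_1-\epsilon\|\widehat{g^*}\|_1\big)$$ whenever the argument of the logarithm is positive. Moreover $\|\widehat{g^*}\|_1\le\sqrt{\|\widehat g\|_0}$, so that this bound refines the bound $$R_\epsilon(g^\oplus)\ \ge\ 2\log\big((1-\epsilon)\|\widehat g\|_1-\epsilon\sqrt{\|\widehat g\|_0}\big),$$ which also holds whenever the argument of its logarithm is positive. -/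

import Mathlib

/-! ### Fourier analysis on the discrete cube

The cube `{+1,-1}^n` is identified with `Fin n → Bool` through `false ↦ +1`, `true ↦ -1`. -/

namespace XorCC

/-- The real number `+1` for the bit `0` and `-1` for the bit `1`. -/
def bitSign (b : Bool) : ℝ := if b then -1 else 1

/-- A boolean function `{0,1}^n → {0,1}`, viewed as a function with values in `{+1,-1}`. -/
def signFun {n : ℕ} (g : (Fin n → Bool) → Bool) : (Fin n → Bool) → ℝ := fun z => bitSign (g z)

/-- The Fourier coefficient of `A` at `S`: the average of `A z * ∏ i ∈ S, z i` over the cube. -/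
noncomputable def fourierCoeff {n : ℕ} (A : (Fin n → Bool) → ℝ) (S : Finset (Fin n)) : ℝ :=
  (1 / 2 ^ n : ℝ) * ∑ z : Fin n → Bool, A z * ∏ i ∈ S, bitSign (z i)

/-- The sum of the absolute values of the Fourier coefficients. -/
noncomputable def fourierL1 {n : ℕ} (A : (Fin n → Bool) → ℝ) : ℝ :=
  ∑ S : Finset (Fin n), |fourierCoeff A S|

/-- The number of nonzero Fourier coefficients. -/
noncomputable def fourierL0 {n : ℕ} (A : (Fin n → Bool) → ℝ) : ℕ :=
  Set.ncard {S : Finset (Fin n) | fourierCoeff A S ≠ 0}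

/-- The set `S_x` of coordinates at which the point `x` of the cube is `-1`. -/
def minusSet {n : ℕ} (x : Fin n → Bool) : Finset (Fin n) := Finset.univ.filter fun i => x i = true

/-- The set `f^*` of functions from the cube to `[-1,1]` whose value at `x` is the sign of the
Fourier coefficient of `f` at `S_x` whenever this coefficient is nonzero. -/
def starSet {n : ℕ} (f : (Fin n → Bool) → ℝ) : Set ((Fin n → Bool) → ℝ) :=
  {h | (∀ x, h x ∈ Set.Icc (-1 : ℝ) 1) ∧
    ∀ x, fourierCoeff f (minusSet x) ≠ 0 → h x = Real.sign (fourierCoeff f (minusSet x))}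

/-- The infimum of the Fourier `ℓ₁` norm over `f^*`. -/
noncomputable def starL1 {n : ℕ} (f : (Fin n → Bool) → ℝ) : ℝ := sInf (fourierL1 '' starSet f)

/-! ### Randomized communication complexity -/

/-- The XOR function `(x, y) ↦ g (x ⊕ y)`. -/
def xorFun {n : ℕ} (g : (Fin n → Bool) → Bool) (x y : Fin n → Bool) : Bool :=
  g fun i => xor (x i) (y i)

/-- Deterministic two-party protocol trees. At a node `alice a p q` Alice, who holds `x`, sends the
bit `a x`, and the protocol goes on with `p` if the bit is `0` and with `q` if it is `1`. Nodes
`bob` are analogous. Leaves are labelled with the output. -/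
inductive Protocol (X Y : Type) : Type
  | output (b : Bool) : Protocol X Y
  | alice (a : X → Bool) (p q : Protocol X Y) : Protocol X Y
  | bob (a : Y → Bool) (p q : Protocol X Y) : Protocol X Y

/-- The output of a protocol on the input `(x, y)`. -/
def Protocol.eval {X Y : Type} : Protocol X Y → X → Y → Bool
  | .output b, _, _ => b
  | .alice a p q, x, y => if a x then q.eval x y else p.eval x y
  | .bob a p q, x, y => if a y then q.eval x y else p.eval x y

/-- The cost of a protocol: the height of its tree, i.e. the largest number of bits exchanged. -/
def Protocol.cost {X Y : Type} : Protocol X Y → ℕ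
  | .output _ => 0
  | .alice _ p q => max p.cost q.cost + 1
  | .bob _ p q => max p.cost q.cost + 1

/-- Some randomized protocol of cost at most `c` computes `f` with error probability at most `ε`
on every input. A randomized protocol (with shared randomness) is a probability distribution over
deterministic protocols. -/
def HasRandomizedProtocol {X Y : Type} (f : X → Y → Bool) (ε : ℝ) (c : ℕ) : Prop :=
  ∃ D : PMF (Protocol X Y), (∀ π ∈ D.support, π.cost ≤ c) ∧
    ∀ x y, D.toOuterMeasure {π | π.eval x y ≠ f x y} ≤ ENNReal.ofReal ε

/-- The randomized communication complexity `R_ε(f)`. -/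
noncomputable def randCC {X Y : Type} (f : X → Y → Bool) (ε : ℝ) : ℕ :=
  sInf {c | HasRandomizedProtocol f ε c}

/-- Every function on a finite set of inputs has a deterministic protocol. -/
theorem exists_protocol {X Y : Type} [Finite X] (f : X → Y → Bool) :
    ∃ π : Protocol X Y, ∀ x y, π.eval x y = f x y := by
  classical
  cases nonempty_fintype X
  have key : ∀ l : List X, ∃ π : Protocol X Y, ∀ x ∈ l, ∀ y, π.eval x y = f x y := by
    intro l
    induction l with
    | nil => exact ⟨.output false, by simp⟩
    | cons a l ih =>
      obtain ⟨π, hπ⟩ := ih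
      refine ⟨.alice (fun x => decide (x = a)) π
        (.bob (fun y => f a y) (.output false) (.output true)), ?_⟩
      intro x hx y
      by_cases hxa : x = a
      · subst hxa
        cases hf : f x y <;> simp [Protocol.eval, hf]
      · have hxl : x ∈ l := by simpa [hxa] using hx
        simp [Protocol.eval, hxa, hπ x hxl y]
  obtain ⟨π, hπ⟩ := key Finset.univ.toList
  exact ⟨π, fun x y => hπ x (by simp) y⟩

/-- The set in the definition of `randCC` is nonempty, so that the infimum is a minimum. -/
theorem exists_hasRandomizedProtocol {X Y : Type} [Finite X] (f : X → Y → Bool) (ε : ℝ) :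
    {c | HasRandomizedProtocol f ε c}.Nonempty := by
  obtain ⟨π, hπ⟩ := exists_protocol f
  refine ⟨π.cost, PMF.pure π, ?_, ?_⟩
  · intro π' h
    simp only [PMF.support_pure, Set.mem_singleton_iff] at h
    rw [h]
  · intro x y
    rw [PMF.toOuterMeasure_pure_apply]
    simp [hπ x y]

end XorCC

/-! Fix h in g^* and let W(x, y) = ĥ(x ⊕ y). The characters diagonalize W with eigenvalues h(z), so
its operator norm is at most 1 and its sum over a rectangle A × B is at most √(|A||B|) in absolute
value (`abs_sum_fourierCoeff_xor_le`). Each exchanged bit splits a rectangle in two and costs a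
factor √2, so a protocol of cost c has correlation at most 2^n √(2^c) with W
(`abs_sum_protocol_le`). The correlation of g^⊕ itself with W is 2^n ‖ĝ‖₁, because h is the sign of
ĝ (`sum_starSet_mul_fourierCoeff`). Errors of probability ε lose on average at most ε 2^n (‖ĝ‖₁ +
‖ĥ‖₁). Hence (1 - ε)‖ĝ‖₁ - ε‖ĥ‖₁ ≤ √(2^c), and a minimizing h gives the bound. -/

namespace XorCC

open Finset

/-! ### Characters of the cube, indexed by points of the cube -/

/-- The character of the cube with index set `minusSet w`, evaluated at `z`. -/
noncomputable def cubeChar {n : ℕ} (w z : Fin n → Bool) : ℝ := ∏ i, bitSign (w i && z i)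

theorem cubeChar_comm {n : ℕ} (w z : Fin n → Bool) : cubeChar w z = cubeChar z w := by
  simp only [cubeChar, Bool.and_comm]

theorem cubeChar_xor {n : ℕ} (x y z : Fin n → Bool) :
    cubeChar (fun i => xor (x i) (y i)) z = cubeChar x z * cubeChar y z := by
  rw [cubeChar, cubeChar, cubeChar, ← prod_mul_distrib]
  refine prod_congr rfl fun i _ => ?_
  cases x i <;> cases y i <;> cases z i <;> norm_num [bitSign]

theorem prod_minusSet {n : ℕ} (w z : Fin n → Bool) :
    ∏ i ∈ minusSet w, bitSign (z i) = cubeChar w z := by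
  rw [minusSet, prod_filter, cubeChar]
  refine prod_congr rfl fun i _ => ?_
  cases w i <;> simp [bitSign]

theorem fourierCoeff_minusSet {n : ℕ} (A : (Fin n → Bool) → ℝ) (w : Fin n → Bool) :
    fourierCoeff A (minusSet w) = (1 / 2 ^ n : ℝ) * ∑ z, A z * cubeChar w z := by
  simp only [fourierCoeff, prod_minusSet]

theorem minusSet_bijective (n : ℕ) : Function.Bijective (minusSet (n := n)) := by
  constructor
  · intro x y h
    funext i
    have hi : i ∈ minusSet x ↔ i ∈ minusSet y := by rw [h]
    simp only [minusSet, mem_filter_univ] at hi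
    exact Bool.eq_iff_iff.mpr hi
  · intro S
    exact ⟨fun i => decide (i ∈ S), by ext; simp [minusSet]⟩

theorem fourierL1_eq_sum_minusSet {n : ℕ} (A : (Fin n → Bool) → ℝ) :
    fourierL1 A = ∑ w, |fourierCoeff A (minusSet w)| :=
  ((minusSet_bijective n).sum_comp fun S => |fourierCoeff A S|).symm

theorem sum_cubeChar_mul_cubeChar {n : ℕ} (x y : Fin n → Bool) :
    ∑ z, cubeChar x z * cubeChar y z = if x = y then (2 : ℝ) ^ n else 0 := by
  simp only [cubeChar, ← prod_mul_distrib]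
  -- The sum over the cube factors into one sum per coordinate.
  rw [← Fintype.prod_sum fun i b => bitSign (x i && b) * bitSign (y i && b)]
  have key : ∀ i, ∑ b : Bool, bitSign (x i && b) * bitSign (y i && b)
      = if x i = y i then (2 : ℝ) else 0 := by
    intro i
    cases x i <;> cases y i <;> norm_num [bitSign]
  simp only [key]
  split_ifs with h
  · simp [h]
  · obtain ⟨i, hi⟩ := Function.ne_iff.mp h
    exact prod_eq_zero (mem_univ i) (if_neg hi)

theorem sum_sq_sum_mul_cubeChar {n : ℕ} (f : (Fin n → Bool) → ℝ) :
    ∑ w, (∑ z, f z * cubeChar w z) ^ 2 = 2 ^ n * ∑ z, f z ^ 2 := by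
  calc ∑ w, (∑ z, f z * cubeChar w z) ^ 2
      = ∑ w, ∑ z, ∑ z', f z * f z' * (cubeChar z w * cubeChar z' w) := by
        refine sum_congr rfl fun w _ => ?_
        rw [sq, sum_mul_sum]
        refine sum_congr rfl fun z _ => sum_congr rfl fun z' _ => ?_
        rw [cubeChar_comm w z, cubeChar_comm w z']
        ring
    _ = ∑ z, ∑ z', f z * f z' * ∑ w, cubeChar z w * cubeChar z' w := by
        rw [sum_comm]
        refine sum_congr rfl fun z _ => ?_
        rw [sum_comm]
        simp only [mul_sum]
    _ = 2 ^ n * ∑ z, f z ^ 2 := by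
        simp only [sum_cubeChar_mul_cubeChar, mul_ite, mul_zero, sum_ite_eq, mem_univ, if_true,
          mul_sum]
        exact sum_congr rfl fun z _ => by ring

/-- With sets indexed by points, the Fourier transform has the symmetric kernel 2^(-n) χ_w(z). -/
theorem sum_mul_fourierCoeff_comm {n : ℕ} (A B : (Fin n → Bool) → ℝ) :
    ∑ w, A w * fourierCoeff B (minusSet w) = ∑ w, B w * fourierCoeff A (minusSet w) := by
  simp only [fourierCoeff_minusSet, mul_sum]
  rw [sum_comm]
  refine sum_congr rfl fun w _ => sum_congr rfl fun z _ => ?_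
  rw [cubeChar_comm]
  ring

/-- Parseval's identity and the Cauchy–Schwarz inequality. -/
theorem fourierL1_le_sqrt {n : ℕ} (A : (Fin n → Bool) → ℝ) :
    fourierL1 A ≤ √(∑ z, A z ^ 2) := by
  refine Real.le_sqrt_of_sq_le ?_
  rw [fourierL1_eq_sum_minusSet]
  refine (sq_sum_le_card_mul_sum_sq).trans (le_of_eq ?_)
  -- The powers of two cancel: 2^n coefficients, the squared normalization 2^(-2n), and 2^n from
  -- Parseval.
  simp only [sq_abs, fourierCoeff_minusSet, mul_pow, ← mul_sum, sum_sq_sum_mul_cubeChar]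
  simp
  field_simp

/-! ### The functions in `starSet f` -/

theorem sign_fourierCoeff_mem_starSet {n : ℕ} (f : (Fin n → Bool) → ℝ) :
    (fun x => Real.sign (fourierCoeff f (minusSet x))) ∈ starSet f := by
  refine ⟨fun x => ?_, fun x _ => rfl⟩
  rcases Real.sign_apply_eq (fourierCoeff f (minusSet x)) with h | h | h <;> norm_num [h]

theorem continuous_fourierL1 (n : ℕ) : Continuous (fourierL1 (n := n)) := by
  unfold fourierL1 fourierCoeff
  fun_prop

theorem isCompact_starSet {n : ℕ} (f : (Fin n → Bool) → ℝ) : IsCompact (starSet f) := by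
  have hc : IsCompact (Set.univ.pi fun _ : Fin n → Bool => Set.Icc (-1 : ℝ) 1) :=
    isCompact_univ_pi fun _ => isCompact_Icc
  refine hc.of_isClosed_subset ?_ fun h hh x _ => hh.1 x
  have : starSet f = (⋂ x, {h | h x ∈ Set.Icc (-1 : ℝ) 1}) ∩
      ⋂ x, ⋂ _ : fourierCoeff f (minusSet x) ≠ 0,
        {h | h x = Real.sign (fourierCoeff f (minusSet x))} := by
    ext h
    simp [starSet]
  rw [this]
  exact (isClosed_iInter fun x => isClosed_Icc.preimage (continuous_apply x)).inter
    (isClosed_iInter fun x => isClosed_iInter fun _ =>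
      isClosed_eq (continuous_apply x) continuous_const)

theorem isLeast_starL1 {n : ℕ} (f : (Fin n → Bool) → ℝ) :
    IsLeast (fourierL1 '' starSet f) (starL1 f) :=
  ((isCompact_starSet f).image (continuous_fourierL1 n)).isLeast_sInf
    (Set.Nonempty.image _ ⟨_, sign_fourierCoeff_mem_starSet f⟩)

/-- Since `Real.sign 0 = 0`, the sign of the Fourier transform is a member of `starSet f` whose
squares sum to the number of nonzero coefficients. -/
theorem starL1_le_sqrt_fourierL0 {n : ℕ} (f : (Fin n → Bool) → ℝ) :
    starL1 f ≤ √(fourierL0 f : ℝ) := by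
  classical
  refine ((isLeast_starL1 f).2 ⟨_, sign_fourierCoeff_mem_starSet f, rfl⟩).trans
    ((fourierL1_le_sqrt _).trans (le_of_eq ?_))
  congr 1
  have h1 : ∀ r : ℝ, Real.sign r ^ 2 = if r ≠ 0 then 1 else 0 := by
    intro r
    rcases lt_trichotomy r 0 with h | h | h
    · simp [Real.sign_of_neg h, h.ne]
    · simp [h]
    · simp [Real.sign_of_pos h, h.ne']
  simp only [h1]
  rw [(minusSet_bijective n).sum_comp fun S => if fourierCoeff f S ≠ 0 then (1 : ℝ) else 0,
    sum_boole, fourierL0, ← Set.ncard_coe_finset]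
  simp

theorem sum_starSet_mul_fourierCoeff {n : ℕ} {f h : (Fin n → Bool) → ℝ} (hh : h ∈ starSet f) :
    ∑ w, f w * fourierCoeff h (minusSet w) = fourierL1 f := by
  rw [sum_mul_fourierCoeff_comm, fourierL1_eq_sum_minusSet]
  refine sum_congr rfl fun w _ => ?_
  by_cases h0 : fourierCoeff f (minusSet w) = 0
  · simp [h0]
  · rw [hh.2 w h0]
    rcases lt_or_gt_of_ne h0 with hneg | hpos
    · rw [Real.sign_of_neg hneg, abs_of_neg hneg, neg_one_mul]
    · rw [Real.sign_of_pos hpos, abs_of_pos hpos, one_mul]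

/-! ### Correlation of protocols with a matrix of small operator norm -/

/-- The matrix `(x, y) ↦ ĥ (x ⊕ y)` has operator norm at most `1` when `h` has values in
`[-1, 1]`. -/
theorem abs_sum_fourierCoeff_xor_le {n : ℕ} {h : (Fin n → Bool) → ℝ} (hh : ∀ x, |h x| ≤ 1)
    (A B : Finset (Fin n → Bool)) :
    |∑ x ∈ A, ∑ y ∈ B, fourierCoeff h (minusSet fun i => xor (x i) (y i))|
      ≤ √((#A : ℝ) * #B) := by
  classical
  -- Parseval for the indicator function of C.
  have hsq : ∀ C : Finset (Fin n → Bool),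
      ∑ z, |∑ x ∈ C, cubeChar x z| ^ 2 = 2 ^ n * (#C : ℝ) := by
    intro C
    have := sum_sq_sum_mul_cubeChar fun x => if x ∈ C then (1 : ℝ) else 0
    simp only [ite_mul, one_mul, zero_mul, ite_pow, one_pow, sum_ite_mem, univ_inter,
      sum_const, nsmul_eq_mul, mul_one, ne_eq, OfNat.ofNat_ne_zero, not_false_eq_true,
      zero_pow] at this
    simp only [sq_abs, cubeChar_comm, ← this]
  have heq : ∑ x ∈ A, ∑ y ∈ B, fourierCoeff h (minusSet fun i => xor (x i) (y i))
      = (1 / 2 ^ n : ℝ) *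
        ∑ z, h z * ((∑ x ∈ A, cubeChar x z) * ∑ y ∈ B, cubeChar y z) := by
    simp only [fourierCoeff_minusSet, cubeChar_xor, sum_mul_sum, ← mul_sum]
    congr 1
    simp only [mul_sum]
    symm
    rw [sum_comm]
    exact sum_congr rfl fun x _ => sum_comm
  rw [heq, abs_mul, abs_of_pos (by positivity : (0 : ℝ) < 1 / 2 ^ n)]
  have hCS : ∑ z, |∑ x ∈ A, cubeChar x z| * |∑ y ∈ B, cubeChar y z|
      ≤ 2 ^ n * √((#A : ℝ) * #B) := by
    refine (Real.sum_mul_le_sqrt_mul_sqrt _ _ _).trans (le_of_eq ?_)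
    rw [hsq, hsq, ← Real.sqrt_mul (by positivity),
      show (2 : ℝ) ^ n * #A * (2 ^ n * #B) = (2 ^ n) ^ 2 * (#A * #B) by ring,
      Real.sqrt_mul (by positivity), Real.sqrt_sq (by positivity)]
  have hle : |∑ z, h z * ((∑ x ∈ A, cubeChar x z) * ∑ y ∈ B, cubeChar y z)|
      ≤ ∑ z, |∑ x ∈ A, cubeChar x z| * |∑ y ∈ B, cubeChar y z| := by
    refine (abs_sum_le_sum_abs _ _).trans (sum_le_sum fun z _ => ?_)
    rw [abs_mul, abs_mul]
    exact mul_le_of_le_one_left (by positivity) (hh z)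
  rw [one_div, inv_mul_le_iff₀ (by positivity)]
  exact hle.trans hCS

/-- This is the loss of a factor √2 when a bit splits a rectangle in two. -/
theorem sqrt_add_sqrt_le (a b : ℝ) (ha : 0 ≤ a) (hb : 0 ≤ b) :
    √a + √b ≤ √(2 * (a + b)) := by
  refine Real.le_sqrt_of_sq_le ?_
  nlinarith [Real.sq_sqrt ha, Real.sq_sqrt hb, sq_nonneg (√a - √b)]

/-- A protocol of cost at most `c` has small correlation with a matrix of operator norm at
most `1`. -/
theorem abs_sum_protocol_le {X Y : Type} {W : X → Y → ℝ}
    (hW : ∀ (A : Finset X) (B : Finset Y), |∑ x ∈ A, ∑ y ∈ B, W x y| ≤ √((#A : ℝ) * #B))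
    (π : Protocol X Y) (c : ℕ) (hc : π.cost ≤ c) (A : Finset X) (B : Finset Y) :
    |∑ x ∈ A, ∑ y ∈ B, bitSign (π.eval x y) * W x y| ≤ √(2 ^ c * ((#A : ℝ) * #B)) := by
  classical
  induction π generalizing c A B with
  | output b =>
    simp only [Protocol.eval, ← mul_sum]
    have hb : |bitSign b| = 1 := by cases b <;> simp [bitSign]
    rw [abs_mul, hb, one_mul]
    refine (hW A B).trans (Real.sqrt_le_sqrt ?_)
    -- A leaf may lie at depth less than c; the slack is absorbed by 1 ≤ 2^c.
    exact le_mul_of_one_le_left (by positivity) (one_le_pow₀ one_le_two)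
  | alice a p q ihp ihq =>
    obtain ⟨d, rfl⟩ : ∃ d, c = d + 1 := ⟨c - 1, by simp only [Protocol.cost] at hc; omega⟩
    simp only [Protocol.cost, add_le_add_iff_right, max_le_iff] at hc
    have hq := ihq d hc.2 (A.filter fun x => a x = true) B
    have hp := ihp d hc.1 (A.filter fun x => ¬ a x = true) B
    have hcard := card_filter_add_card_filter_not (s := A) (fun x => a x = true)
    have hsplit : ∑ x ∈ A, ∑ y ∈ B, bitSign ((Protocol.alice a p q).eval x y) * W x y
        = (∑ x ∈ A.filter fun x => a x = true, ∑ y ∈ B, bitSign (q.eval x y) * W x y)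
          + ∑ x ∈ A.filter fun x => ¬ a x = true, ∑ y ∈ B, bitSign (p.eval x y) * W x y := by
      rw [← sum_filter_add_sum_filter_not A fun x => a x = true]
      congr 1 <;> refine sum_congr rfl fun x hx => sum_congr rfl fun y _ => ?_ <;>
        simp [Protocol.eval, (mem_filter.mp hx).2]
    rw [hsplit]
    refine (abs_add_le _ _).trans ((add_le_add hq hp).trans
      ((sqrt_add_sqrt_le _ _ (by positivity) (by positivity)).trans (le_of_eq ?_)))
    rw [← hcard]
    push_cast
    ring_nf
  | bob a p q ihp ihq =>
    obtain ⟨d, rfl⟩ : ∃ d, c = d + 1 := ⟨c - 1, by simp only [Protocol.cost] at hc; omega⟩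
    simp only [Protocol.cost, add_le_add_iff_right, max_le_iff] at hc
    have hq := ihq d hc.2 A (B.filter fun y => a y = true)
    have hp := ihp d hc.1 A (B.filter fun y => ¬ a y = true)
    have hcard := card_filter_add_card_filter_not (s := B) (fun y => a y = true)
    have hsplit : ∑ x ∈ A, ∑ y ∈ B, bitSign ((Protocol.bob a p q).eval x y) * W x y
        = (∑ x ∈ A, ∑ y ∈ B.filter fun y => a y = true, bitSign (q.eval x y) * W x y)
          + ∑ x ∈ A, ∑ y ∈ B.filter fun y => ¬ a y = true, bitSign (p.eval x y) * W x y := by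
      rw [← sum_add_distrib]
      refine sum_congr rfl fun x _ => ?_
      rw [← sum_filter_add_sum_filter_not B fun y => a y = true]
      congr 1 <;> refine sum_congr rfl fun y hy => ?_ <;>
        simp [Protocol.eval, (mem_filter.mp hy).2]
    rw [hsplit]
    refine (abs_add_le _ _).trans ((add_le_add hq hp).trans
      ((sqrt_add_sqrt_le _ _ (by positivity) (by positivity)).trans (le_of_eq ?_)))
    rw [← hcard]
    push_cast
    ring_nf

/-! ### Averaging over a randomized protocol -/

/-- If a quantity is at most `K` plus a weighted number of errors for every protocol in the
support of a randomized protocol with error `ε`, then it is at most `K` plus `ε` times the total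
weight. -/
theorem le_of_forall_le_add_sum_error {α ι : Type*} [Fintype ι] (D : PMF α) (E : ι → Set α)
    {ε : ℝ} (hε : 0 ≤ ε) (hE : ∀ i, D.toOuterMeasure (E i) ≤ ENNReal.ofReal ε)
    (w : ι → ℝ) (hw : ∀ i, 0 ≤ w i) (T K : ℝ)
    (h : ∀ π ∈ D.support, T ≤ K + ∑ i, w i * (E i).indicator 1 π) :
    T ≤ K + ε * ∑ i, w i := by
  have hD : HasSum (fun π => (D π).toReal) 1 := by
    have := ENNReal.hasSum_toReal (f := D) (by simp [D.tsum_coe])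
    simpa [← ENNReal.tsum_toReal_eq D.apply_ne_top, D.tsum_coe] using this
  have hsum : ∀ i, Summable fun π => (D π).toReal * (E i).indicator 1 π := by
    intro i
    refine hD.summable.of_nonneg_of_le (fun π => ?_) fun π => ?_
    · exact mul_nonneg ENNReal.toReal_nonneg (Set.indicator_nonneg (by simp) _)
    · refine mul_le_of_le_one_right ENNReal.toReal_nonneg ?_
      exact Set.indicator_le_self' (by simp) π
  have herr : ∀ i, ∑' π, (D π).toReal * (E i).indicator 1 π ≤ ε := by
    intro i
    have h1 := ENNReal.toReal_mono ENNReal.ofReal_ne_top (hE i)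
    rw [ENNReal.toReal_ofReal hε, PMF.toOuterMeasure_apply, ENNReal.tsum_toReal_eq] at h1
    · refine (le_of_eq (tsum_congr fun π => ?_)).trans h1
      by_cases hπ : π ∈ E i <;> simp [hπ]
    · intro π
      by_cases hπ : π ∈ E i <;> simp [hπ, D.apply_ne_top]
  -- The expectation of the right-hand side; `Protocol` is infinite, so summability has to be
  -- carried along.
  have hR : HasSum (fun π => (D π).toReal * K
      + ∑ i, w i * ((D π).toReal * (E i).indicator 1 π))
      (1 * K + ∑ i, w i * ∑' π, (D π).toReal * (E i).indicator 1 π) :=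
    (hD.mul_right K).add (hasSum_sum fun i _ => (hsum i).hasSum.mul_left (w i))
  have hle := hasSum_le (fun π => ?_) (hD.mul_right T) hR
  · rw [one_mul, one_mul] at hle
    refine hle.trans (add_le_add le_rfl ?_)
    rw [mul_sum]
    exact sum_le_sum fun i _ => by nlinarith [herr i, hw i]
  · by_cases hπ : π ∈ D.support
    · refine (mul_le_mul_of_nonneg_left (h π hπ) ENNReal.toReal_nonneg).trans (le_of_eq ?_)
      rw [mul_add, mul_sum]
      congr 1
      exact sum_congr rfl fun i _ => by ring
    · have : D π = 0 := by simpa [PMF.mem_support_iff] using hπ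
      simp [this]

theorem sum_xor {n : ℕ} (F : (Fin n → Bool) → ℝ) :
    ∑ x : Fin n → Bool, ∑ y : Fin n → Bool, F (fun i => xor (x i) (y i)) = 2 ^ n * ∑ w, F w := by
  have key : ∀ x : Fin n → Bool, ∑ y : Fin n → Bool, F (fun i => xor (x i) (y i)) = ∑ w, F w := by
    intro x
    refine Function.Bijective.sum_comp (e := fun y : Fin n → Bool => fun i => xor (x i) (y i))
      (Function.Involutive.bijective fun y => ?_) F
    funext i
    simp
  simp [key]

theorem le_sqrt_of_hasRandomizedProtocol {n : ℕ} (g : (Fin n → Bool) → Bool) {ε : ℝ}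
    (hε : 0 ≤ ε) {c : ℕ} (hc : HasRandomizedProtocol (xorFun g) ε c)
    {h : (Fin n → Bool) → ℝ} (hh : h ∈ starSet (signFun g)) :
    (1 - ε) * fourierL1 (signFun g) - ε * fourierL1 h ≤ √(2 ^ c) := by
  obtain ⟨D, hcost, herr⟩ := hc
  set W : (Fin n → Bool) → (Fin n → Bool) → ℝ :=
    fun x y => fourierCoeff h (minusSet fun i => xor (x i) (y i)) with hWdef
  have hW : ∀ A B : Finset (Fin n → Bool), |∑ x ∈ A, ∑ y ∈ B, W x y| ≤ √((#A : ℝ) * #B) :=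
    abs_sum_fourierCoeff_xor_le fun x => abs_le.mpr (hh.1 x)
  set V : (Fin n → Bool) × (Fin n → Bool) → ℝ :=
    fun p => bitSign (xorFun g p.1 p.2) * W p.1 p.2 with hVdef
  have hV : ∑ p, V p = 2 ^ n * fourierL1 (signFun g) := by
    rw [Fintype.sum_prod_type, ← sum_starSet_mul_fourierCoeff hh]
    exact sum_xor fun w => signFun g w * fourierCoeff h (minusSet w)
  have hVabs : ∑ p, |V p| = 2 ^ n * fourierL1 h := by
    rw [Fintype.sum_prod_type, fourierL1_eq_sum_minusSet,
      ← sum_xor fun w => |fourierCoeff h (minusSet w)|]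
    refine sum_congr rfl fun x _ => sum_congr rfl fun y _ => ?_
    have hb : ∀ b, |bitSign b| = 1 := by intro b; cases b <;> simp [bitSign]
    simp only [hVdef, hWdef, abs_mul, hb, one_mul]
  -- An error at p changes the correlation by 2 V p, which is at most the nonnegative weight V p +
  -- |V p|.
  have hmain := le_of_forall_le_add_sum_error D
    (fun p : (Fin n → Bool) × (Fin n → Bool) => {π | π.eval p.1 p.2 ≠ xorFun g p.1 p.2})
    hε (fun p => herr p.1 p.2) (fun p => V p + |V p|)
    (fun p => by linarith [neg_abs_le (V p)]) (∑ p, V p) (2 ^ n * √(2 ^ c)) ?_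
  · rw [sum_add_distrib, hV, hVabs] at hmain
    have h2 : (0 : ℝ) < 2 ^ n := by positivity
    refine le_of_mul_le_mul_left ?_ h2
    linarith
  · intro π hπ
    have h1 := (abs_le.mp (abs_sum_protocol_le hW π c (hcost π hπ) univ univ)).2
    have h3 : √(2 ^ c * ((#(univ : Finset (Fin n → Bool)) : ℝ) * #(univ : Finset (Fin n → Bool))))
        = 2 ^ n * √(2 ^ c) := by
      rw [Real.sqrt_mul (by positivity), Real.sqrt_mul_self (by positivity)]
      simp [mul_comm]
    rw [h3, ← Fintype.sum_prod_type'] at h1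
    rw [← sub_le_iff_le_add, ← sum_sub_distrib]
    refine le_trans (sum_le_sum fun p _ => ?_) h1
    by_cases hp : π.eval p.1 p.2 = xorFun g p.1 p.2
    · simp [hp, hVdef]
    · have hneg : bitSign (π.eval p.1 p.2) = - bitSign (xorFun g p.1 p.2) := by
        revert hp
        cases π.eval p.1 p.2 <;> cases xorFun g p.1 p.2 <;> simp [bitSign]
      rw [hneg, neg_mul]
      simp only [ne_eq, Set.mem_ofPred_eq, hp, not_false_eq_true, Set.indicator_of_mem,
        Pi.one_apply, mul_one]
      linarith [le_abs_self (V p)]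

/-- The free parameter t lets one statement serve both bounds of the theorem. -/
theorem two_mul_logb_le_randCC {n : ℕ} (g : (Fin n → Bool) → Bool) {ε : ℝ} (hε : 0 ≤ ε) {t : ℝ}
    (ht : 0 < t) (h : t ≤ (1 - ε) * fourierL1 (signFun g) - ε * starL1 (signFun g)) :
    2 * Real.logb 2 t ≤ (randCC (xorFun g) ε : ℝ) := by
  obtain ⟨k, hk, hkeq⟩ := (isLeast_starL1 (signFun g)).1
  have hc := Nat.sInf_mem (exists_hasRandomizedProtocol (xorFun g) ε)
  have hle := le_sqrt_of_hasRandomizedProtocol g hε hc hk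
  rw [hkeq] at hle
  have hsq : t ^ 2 ≤ 2 ^ randCC (xorFun g) ε := (Real.le_sqrt' ht).mp (h.trans hle)
  have hlog := Real.logb_le_logb_of_le one_lt_two (by positivity) hsq
  rw [Real.logb_pow, Real.logb_pow, Real.logb_self_eq_one one_lt_two, mul_one] at hlog
  exact_mod_cast hlog

end XorCC

theorem mainTheorem8 (n : ℕ) (g : (Fin n → Bool) → Bool) (ε : ℝ) (hε₀ : 0 ≤ ε) (hε₁ : ε ≤ 1 / 2) :
    IsLeast (XorCC.fourierL1 '' XorCC.starSet (XorCC.signFun g))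
      (XorCC.starL1 (XorCC.signFun g)) ∧
    (0 < (1 - ε) * XorCC.fourierL1 (XorCC.signFun g) - ε * XorCC.starL1 (XorCC.signFun g) →
      (XorCC.randCC (XorCC.xorFun g) ε : ℝ) ≥
        2 * Real.logb 2 ((1 - ε) * XorCC.fourierL1 (XorCC.signFun g)
          - ε * XorCC.starL1 (XorCC.signFun g))) ∧
    XorCC.starL1 (XorCC.signFun g) ≤ √(XorCC.fourierL0 (XorCC.signFun g) : ℝ) ∧
    (0 < (1 - ε) * XorCC.fourierL1 (XorCC.signFun g)
        - ε * √(XorCC.fourierL0 (XorCC.signFun g) : ℝ) →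
      (XorCC.randCC (XorCC.xorFun g) ε : ℝ) ≥
        2 * Real.logb 2 ((1 - ε) * XorCC.fourierL1 (XorCC.signFun g)
          - ε * √(XorCC.fourierL0 (XorCC.signFun g) : ℝ))) := by
  refine ⟨XorCC.isLeast_starL1 _, fun h => XorCC.two_mul_logb_le_randCC g hε₀ h le_rfl,
    XorCC.starL1_le_sqrt_fourierL0 _, fun h => XorCC.two_mul_logb_le_randCC g hε₀ h ?_⟩
  exact sub_le_sub_left
    (mul_le_mul_of_nonneg_left (XorCC.starL1_le_sqrt_fourierL0 (XorCC.signFun g)) hε₀) _
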